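/- Let $C_1,C_2,C_3\in\mathbb R$ with $2C_1+C_2>0$ and $0<C_3<C_{3,critical}:=\frac1{27}(2C_1+C_2)^3$, and let $$U(\phi)=-\tfrac12\phi^2-\tfrac12C_2\phi-\tfrac12C_1C_2-\frac{C_3}{2(\phi-C_1)},\qquad \phi\neq C_1.$$ (The smooth periodic travelling waves of the Dullin–Gottwald–Holm equation satisfy $b=\frac12(d\phi/dz)^2+U(\phi)$, where $b$ is a constant of integration and $z$ is the rescaled travelling-wave variable.) Then $U$ has exactly three critical points $\phi_1<\phi_2<\phi_3$, and $-\frac{C_2}{2}<\phi_1<\frac{C_1-C_2}{3}<\phi_2<C_1<\phi_3$. Put $b_-=U(\phi_2)$ and $b_+=U(\phi_1)$; then $b_-<b_+$. For every $b\in(b_-,b_+)$ the equation $U(\phi)=b$ has exactly two solutions $\phi_-(b)<\phi_+(b)$ in $(\phi_1,C_1)$ (the turning points); they satisfy $\phi_1<\phi_-(b)<\phi_2<\phi_+(b)<C_1$, one has $U<b$ on $(\phi_-(b),\phi_+(b))$, and the integral $$\mathfrak L(C_1,C_2,C_3,b)=2\int_{\phi_-(b)}^{\phi_+(b)}\sqrt{\frac{1}{2\,[\,b-U(\phi)\,]}}\;d\phi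 ,$$ which defines the period function of the smooth periodic waves, converges. For fixed $C_1,C_2,C_3$ as above, the period function $b\mapsto\mathfrak L(C_1,C_2,C_3,b)$ is strictly increasing on $(b_-,b_+)$. -/

import Mathlib

/-! Notions for the smooth periodic travelling waves of the Dullin–Gottwald–Holm equation, written
as Newton's equation `b = (1/2) (dφ/dz)^2 + U φ` with total energy `b`. -/

namespace DGH

noncomputable section

/-- The potential energy `U` of the travelling wave equation; `φ = C₁` is its pole. -/
def U (C₁ C₂ C₃ φ : ℝ) : ℝ :=
  -(1 / 2) * φ ^ 2 - (1 / 2) * C₂ * φ - (1 / 2) * C₁ * C₂ - C₃ / (2 * (φ - C₁))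

/-- The critical value of `C₃`. -/
def C₃critical (C₁ C₂ : ℝ) : ℝ := (1 / 27) * (2 * C₁ + C₂) ^ 3

/-- The critical points of `U`. For `C₃ ≠ 0` the pole `C₁` is not among them, since `U` is not
continuous there. -/
def critSet (C₁ C₂ C₃ : ℝ) : Set ℝ := {φ | HasDerivAt (U C₁ C₂ C₃) 0 φ}

/-- The first critical point of `U` (the saddle): the one in `(-C₂/2, (C₁-C₂)/3)`. -/
def φ₁ (C₁ C₂ C₃ : ℝ) : ℝ := sInf (critSet C₁ C₂ C₃ ∩ Set.Ioo (-C₂ / 2) ((C₁ - C₂) / 3))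

/-- The second critical point of `U` (the center): the one in `((C₁-C₂)/3, C₁)`. -/
def φ₂ (C₁ C₂ C₃ : ℝ) : ℝ := sInf (critSet C₁ C₂ C₃ ∩ Set.Ioo ((C₁ - C₂) / 3) C₁)

/-- The third critical point of `U`: the one in `(C₁, ∞)`. -/
def φ₃ (C₁ C₂ C₃ : ℝ) : ℝ := sInf (critSet C₁ C₂ C₃ ∩ Set.Ioi C₁)

/-- The energy `b₋` of the center. -/
def bMinus (C₁ C₂ C₃ : ℝ) : ℝ := U C₁ C₂ C₃ (φ₂ C₁ C₂ C₃)

/-- The energy `b₊` of the saddle, i.e. of the homoclinic orbit. -/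
def bPlus (C₁ C₂ C₃ : ℝ) : ℝ := U C₁ C₂ C₃ (φ₁ C₁ C₂ C₃)

/-- The left turning point `φ₋` at energy `b`: the solution of `U φ = b` in `(φ₁, φ₂)`. -/
def φMinus (C₁ C₂ C₃ b : ℝ) : ℝ :=
  sInf {φ | φ ∈ Set.Ioo (φ₁ C₁ C₂ C₃) (φ₂ C₁ C₂ C₃) ∧ U C₁ C₂ C₃ φ = b}

/-- The right turning point `φ₊` at energy `b`: the solution of `U φ = b` in `(φ₂, C₁)`. -/
def φPlus (C₁ C₂ C₃ b : ℝ) : ℝ :=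
  sInf {φ | φ ∈ Set.Ioo (φ₂ C₁ C₂ C₃) C₁ ∧ U C₁ C₂ C₃ φ = b}

/-- The integrand of the period function. -/
def periodIntegrand (C₁ C₂ C₃ b φ : ℝ) : ℝ := Real.sqrt (1 / (2 * (b - U C₁ C₂ C₃ φ)))

/-- The period function of the smooth periodic waves. -/
def period (C₁ C₂ C₃ b : ℝ) : ℝ :=
  2 * ∫ φ in (φMinus C₁ C₂ C₃ b)..(φPlus C₁ C₂ C₃ b), periodIntegrand C₁ C₂ C₃ b φ

end

end DGH

open Set Filter Topology MeasureTheory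

namespace DGH

/-! In the coordinate `x = C₁ - φ` one has `2 (b - U) = (x - p) (q - x) (r - x) / x`, where `p + q +
r = 2 C₁ + C₂` and `p q r = C₃` do not depend on `b` (`two_mul_sub_U`, `mul_turning_points`). Here
`p < q` are the turning points and `r > q`; raising `b` lowers `p` and `r` and raises `q`.

The affine substitution sending `[p, q]` to `[-1, 1]` turns the period integral into that of `√(x /
(r - x))` against the fixed weight `1 / √(1 - t²)`. After adding the values at `t` and `-t`, the
integrand increases pointwise with `b` (`sqrt_profile_add_lt`): both the larger of the two terms and
their product increase. -/

/-! ### Comparison of the normalized period integrals. -/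

lemma add_lt_add_of_mul_lt_mul {A B A' B' : ℝ} (hB : 0 ≤ B) (hBA : B ≤ A) (hA : A < A')
    (hP : A * B < A' * B') : A + B < A' + B' := by
  have hA' : 0 < A' := by linarith
  -- `A' ((A' + B') - (A + B))` exceeds `(A' - A) (A' - B) ≥ 0`.
  rw [← mul_lt_mul_iff_right₀ hA']
  nlinarith [mul_nonneg (sub_nonneg.2 hA.le) (sub_nonneg.2 (hBA.trans hA.le))]

/-- With fixed sum and product, spreading the two smaller roots increases the symmetrized
profile. -/
lemma sqrt_profile_add_lt {p q r p' q' r' t : ℝ} (hp' : 0 < p') (hp : p' < p) (hpq : p < q)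
    (hq : q < q') (hqr : q' < r') (hr : r' < r) (hsum : p + q + r = p' + q' + r')
    (hprod : p * q * r = p' * q' * r') (ht : t ∈ Ico (0 : ℝ) 1) :
    √(((p + q) / 2 + (q - p) / 2 * t) / (r - ((p + q) / 2 + (q - p) / 2 * t))) +
      √(((p + q) / 2 - (q - p) / 2 * t) / (r - ((p + q) / 2 - (q - p) / 2 * t))) <
    √(((p' + q') / 2 + (q' - p') / 2 * t) / (r' - ((p' + q') / 2 + (q' - p') / 2 * t))) +
      √(((p' + q') / 2 - (q' - p') / 2 * t) / (r' - ((p' + q') / 2 - (q' - p') / 2 * t))) := by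
  obtain ⟨ht0, ht1⟩ := ht
  set m := (p + q) / 2 with hm
  set h := (q - p) / 2 with hh
  set m' := (p' + q') / 2 with hm'
  set h' := (q' - p') / 2 with hh'
  have hmm : m < m' := by linarith
  have hhh : h < h' := by linarith
  have hh0 : 0 < h := by linarith
  have hht : h * t ≤ h' * t := by gcongr
  have hht0 : 0 ≤ h * t := by positivity
  have hht1 : h * t ≤ h := mul_le_of_le_one_right hh0.le ht1.le
  have hht1' : h' * t ≤ h' := mul_le_of_le_one_right (hh0.trans hhh).le ht1.le
  -- The product of all three roots is fixed and the third root drops.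
  have hle : p * q < p' * q' := by
    have h1 : 0 < p' * q' := mul_pos hp' (by linarith)
    have h2 : p * q * r < p' * q' * r := by rw [hprod]; gcongr
    exact lt_of_mul_lt_mul_right h2 (by linarith)
  -- Although `h` grows too, this is a combination of `m²` and `p q` with weights `1 - t²` and `t²`,
  -- and both grow.
  have hN : m ^ 2 - (h * t) ^ 2 < m' ^ 2 - (h' * t) ^ 2 := by
    have e1 : m ^ 2 - (h * t) ^ 2 = m ^ 2 * (1 - t ^ 2) + p * q * t ^ 2 := by rw [hm, hh]; ring
    have e2 : m' ^ 2 - (h' * t) ^ 2 = m' ^ 2 * (1 - t ^ 2) + p' * q' * t ^ 2 := by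
      rw [hm', hh']; ring
    have ht2 : 0 < 1 - t ^ 2 := by nlinarith
    have hm2 : m ^ 2 < m' ^ 2 := by gcongr; linarith
    rw [e1, e2]
    exact add_lt_add_of_lt_of_le (by gcongr) (by gcongr)
  have hN0 : 0 ≤ m ^ 2 - (h * t) ^ 2 := by
    have : 0 ≤ (m - h * t) * (m + h * t) := mul_nonneg (by linarith) (by linarith)
    linarith
  have hD : (r' - m') ^ 2 - (h' * t) ^ 2 ≤ (r - m) ^ 2 - (h * t) ^ 2 := by
    have h1 : (r' - m') ^ 2 ≤ (r - m) ^ 2 := by gcongr; linarith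
    have h2 : (h * t) ^ 2 ≤ (h' * t) ^ 2 := by gcongr
    linarith
  have hD0 : 0 < (r' - m') ^ 2 - (h' * t) ^ 2 := by
    have : 0 < (r' - m' - h' * t) * (r' - m' + h' * t) := mul_pos (by linarith) (by linarith)
    linarith
  apply add_lt_add_of_mul_lt_mul (Real.sqrt_nonneg _)
  · apply Real.sqrt_le_sqrt
    apply div_le_div₀ <;> linarith
  · apply Real.sqrt_lt_sqrt
    · apply div_nonneg <;> linarith
    · apply div_lt_div₀ <;> linarith
  · rw [← Real.sqrt_mul (div_nonneg (by linarith) (by linarith)),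
      ← Real.sqrt_mul (div_nonneg (by linarith) (by linarith)), div_mul_div_comm, div_mul_div_comm]
    have e : ∀ x y : ℝ, (x + y) * (x - y) = x ^ 2 - y ^ 2 := fun x y => by ring
    have e' : ∀ s x y : ℝ, (s - (x + y)) * (s - (x - y)) = (s - x) ^ 2 - y ^ 2 :=
      fun s x y => by ring
    rw [e, e, e', e']
    exact Real.sqrt_lt_sqrt (div_nonneg hN0 (by linarith)) (div_lt_div₀ hN hD (by linarith) hD0)

/-- The period integrand after the affine substitution sending the turning points to `±1`. -/
noncomputable def profile (p q r t : ℝ) : ℝ :=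
  √(1 - t ^ 2)⁻¹ *
    √(((p + q) / 2 - (q - p) / 2 * t) / (r - ((p + q) / 2 - (q - p) / 2 * t)))

lemma intervalIntegrable_profile {p q r : ℝ} (hpq : p < q) (hqr : q < r) :
    IntervalIntegrable (profile p q r) volume (-1) 1 := by
  refine Polynomial.Chebyshev.intervalIntegrable_sqrt_one_sub_sq_inv.mul_continuousOn ?_
  refine ContinuousOn.sqrt (ContinuousOn.div (by fun_prop) (by fun_prop) fun t ht => ?_)
  rw [uIcc_of_le (by norm_num)] at ht
  nlinarith [ht.1, ht.2]

/-- The profiles are compared only after symmetrization in `t`: near `t = 1` the numerator is close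
to the smallest root, which decreases. -/
lemma integral_profile_lt {p q r p' q' r' : ℝ} (hp' : 0 < p') (hp : p' < p) (hpq : p < q)
    (hq : q < q') (hqr : q' < r') (hr : r' < r) (hsum : p + q + r = p' + q' + r')
    (hprod : p * q * r = p' * q' * r') :
    ∫ t in (-1)..1, profile p q r t < ∫ t in (-1)..1, profile p' q' r' t := by
  have hI := intervalIntegrable_profile hpq (hq.trans (hqr.trans hr))
  have hI' := intervalIntegrable_profile ((hp.trans hpq).trans hq) hqr
  have hneg : ∀ {f : ℝ → ℝ}, IntervalIntegrable f volume (-1) 1 →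
      IntervalIntegrable (fun t => f (-t)) volume (-1) 1 := fun hf => by
    simpa using ((IntervalIntegrable.iff_comp_neg (f := _)).1 hf).symm
  have hsymm : ∀ {f : ℝ → ℝ}, IntervalIntegrable f volume (-1) 1 →
      ∫ t in (-1)..1, (f (-t) + f t) = 2 * ∫ t in (-1)..1, f t := fun {f} hf => by
    rw [intervalIntegral.integral_add (hneg hf) hf, intervalIntegral.integral_comp_neg, neg_neg]
    ring
  have key : ∀ t ∈ Ico (0 : ℝ) 1,
      profile p q r (-t) + profile p q r t < profile p' q' r' (-t) + profile p' q' r' t := by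
    intro t ht
    have h := sqrt_profile_add_lt hp' hp hpq hq hqr hr hsum hprod ht
    have ht2 : 0 < √(1 - t ^ 2)⁻¹ := by
      have : 0 < 1 - t ^ 2 := by nlinarith [ht.1, ht.2]
      positivity
    simp only [profile, neg_sq, mul_neg, sub_neg_eq_add, ← mul_add]
    exact mul_lt_mul_of_pos_left h ht2
  have hpos := intervalIntegral.intervalIntegral_pos_of_pos_on
    (((hneg hI').add hI').sub ((hneg hI).add hI)) (fun t ht => ?_) (by norm_num : (-1 : ℝ) < 1)
  · have h1 := intervalIntegral.integral_sub ((hneg hI').add hI') ((hneg hI).add hI)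
    have h2 := hsymm hI
    have h3 := hsymm hI'
    linarith
  · rw [sub_pos]
    rcases le_total 0 t with h0 | h0
    · exact key t ⟨h0, ht.2⟩
    · have := key (-t) ⟨by linarith, by linarith [ht.1]⟩
      rw [neg_neg] at this
      linarith

/-! ### Cubic factorization at fixed energy and the affine substitution. -/

lemma U_sub (C₁ C₂ C₃ x : ℝ) : U C₁ C₂ C₃ (C₁ - x) =
    ((2 * C₁ + C₂) * x - x ^ 2 + C₃ / x) / 2 - C₁ ^ 2 / 2 - C₁ * C₂ := by
  have : C₃ / (2 * (C₁ - x - C₁)) = -(C₃ / x) / 2 := by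
    rw [show 2 * (C₁ - x - C₁) = -(x * 2) by ring, div_neg, ← div_div]; ring
  rw [U, this]; ring

/-- Vieta's relation for the two turning points and the third root. -/
lemma mul_turning_points {C₁ C₂ C₃ b p q : ℝ} (hp : 0 < p) (hpq : p < q)
    (hUp : U C₁ C₂ C₃ (C₁ - p) = b) (hUq : U C₁ C₂ C₃ (C₁ - q) = b) :
    p * q * (2 * C₁ + C₂ - p - q) = C₃ := by
  have hq := hp.trans hpq
  rw [← hUp, U_sub, U_sub] at hUq
  field_simp at hUq
  have : (q - p) * (p * q * (2 * C₁ + C₂ - p - q) - C₃) = 0 := by linarith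
  rcases mul_eq_zero.1 this with h | h <;> linarith

/-- Factorization of the kinetic energy through the turning points. -/
lemma two_mul_sub_U {C₁ C₂ C₃ b p q x : ℝ} (hp : 0 < p) (hpq : p < q)
    (hUp : U C₁ C₂ C₃ (C₁ - p) = b) (hUq : U C₁ C₂ C₃ (C₁ - q) = b) (hx : x ≠ 0) :
    2 * (b - U C₁ C₂ C₃ (C₁ - x)) = (x - p) * (q - x) * (2 * C₁ + C₂ - p - q - x) / x := by
  rw [← hUp, U_sub, U_sub, ← mul_turning_points hp hpq hUp hUq]
  field_simp
  ring

/-- The substitution gives `(x - p) (q - x) = ((q - p) / 2)² (1 - t²)`. The endpoints `t = ±1` are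
included because both sides are `0` there, division by zero being `0`. -/
lemma periodIntegrand_eq_profile {C₁ C₂ C₃ b p q t : ℝ} (hp : 0 < p) (hpq : p < q)
    (hUp : U C₁ C₂ C₃ (C₁ - p) = b) (hUq : U C₁ C₂ C₃ (C₁ - q) = b) (ht : t ∈ Icc (-1 : ℝ) 1) :
    periodIntegrand C₁ C₂ C₃ b ((q - p) / 2 * t + (C₁ - (p + q) / 2)) =
      ((q - p) / 2)⁻¹ * profile p q (2 * C₁ + C₂ - p - q) t := by
  set r := 2 * C₁ + C₂ - p - q with hr
  set x := (p + q) / 2 - (q - p) / 2 * t with hx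
  have hh : 0 < (q - p) / 2 := by linarith
  have hx0 : 0 < x := by nlinarith [ht.1, ht.2]
  have hs : (0 : ℝ) ≤ (1 - t ^ 2)⁻¹ := inv_nonneg.2 (by nlinarith [ht.1, ht.2])
  have e : (q - p) / 2 * t + (C₁ - (p + q) / 2) = C₁ - x := by rw [hx]; ring
  rw [e, periodIntegrand, two_mul_sub_U hp hpq hUp hUq hx0.ne', profile, ← hx, ← hr,
    ← Real.sqrt_mul hs]
  nth_rw 1 [← Real.sqrt_sq (inv_nonneg.2 hh.le)]
  rw [← Real.sqrt_mul (sq_nonneg _)]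
  have e2 : (x - p) * (q - x) = ((q - p) / 2) ^ 2 * (1 - t ^ 2) := by rw [hx]; ring
  rw [e2, one_div_div, div_eq_mul_inv, div_eq_mul_inv, mul_inv, mul_inv, inv_pow]
  congr 1
  ring

lemma intervalIntegrable_periodIntegrand {C₁ C₂ C₃ b p q : ℝ} (hp : 0 < p) (hpq : p < q)
    (hqr : q < 2 * C₁ + C₂ - p - q)
    (hUp : U C₁ C₂ C₃ (C₁ - p) = b) (hUq : U C₁ C₂ C₃ (C₁ - q) = b) :
    IntervalIntegrable (periodIntegrand C₁ C₂ C₃ b) volume (C₁ - q) (C₁ - p) := by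
  have hh : (q - p) / 2 ≠ 0 := by linarith
  have h1 : IntervalIntegrable
      (fun t => periodIntegrand C₁ C₂ C₃ b ((q - p) / 2 * t + (C₁ - (p + q) / 2)))
      volume (-1) 1 := by
    refine ((intervalIntegrable_profile hpq hqr).const_mul ((q - p) / 2)⁻¹).congr_uIoo ?_
    intro t ht
    rw [uIoo_of_le (by norm_num)] at ht
    exact (periodIntegrand_eq_profile hp hpq hUp hUq (Ioo_subset_Icc_self ht)).symm
  have e1 : (-1 : ℝ) = (C₁ - q - (C₁ - (p + q) / 2)) / ((q - p) / 2) := by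
    rw [eq_div_iff hh]; ring
  have e2 : (1 : ℝ) = (C₁ - p - (C₁ - (p + q) / 2)) / ((q - p) / 2) := by
    rw [eq_div_iff hh]; ring
  rw [e1, e2] at h1
  have h2 := (IntervalIntegrable.comp_mul_left_iff
    (f := fun s => periodIntegrand C₁ C₂ C₃ b (s + (C₁ - (p + q) / 2))) hh).1 h1
  simpa using (IntervalIntegrable.comp_add_right_iff).1 h2

lemma integral_periodIntegrand {C₁ C₂ C₃ b p q : ℝ} (hp : 0 < p) (hpq : p < q)
    (hUp : U C₁ C₂ C₃ (C₁ - p) = b) (hUq : U C₁ C₂ C₃ (C₁ - q) = b) :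
    ∫ φ in (C₁ - q)..(C₁ - p), periodIntegrand C₁ C₂ C₃ b φ =
      ∫ t in (-1)..1, profile p q (2 * C₁ + C₂ - p - q) t := by
  have hh : (q - p) / 2 ≠ 0 := by linarith
  have h := intervalIntegral.smul_integral_comp_mul_add (a := -1) (b := 1)
    (periodIntegrand C₁ C₂ C₃ b) ((q - p) / 2) (C₁ - (p + q) / 2)
  rw [show (q - p) / 2 * (-1) + (C₁ - (p + q) / 2) = C₁ - q by ring,
    show (q - p) / 2 * 1 + (C₁ - (p + q) / 2) = C₁ - p by ring] at h
  rw [← h, intervalIntegral.integral_congr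
    (g := fun t => ((q - p) / 2)⁻¹ * profile p q (2 * C₁ + C₂ - p - q) t),
    intervalIntegral.integral_const_mul, smul_eq_mul, mul_inv_cancel_left₀ hh]
  intro t ht
  rw [uIcc_of_le (by norm_num)] at ht
  exact periodIntegrand_eq_profile hp hpq hUp hUq ht

/-! ### Critical points of the potential. -/

lemma hasDerivAt_U (C₁ C₂ C₃ : ℝ) {φ : ℝ} (h : φ ≠ C₁) :
    HasDerivAt (U C₁ C₂ C₃)
      ((C₃ - (C₁ - φ) ^ 2 * (2 * C₁ + C₂ - 2 * (C₁ - φ))) / (2 * (C₁ - φ) ^ 2)) φ := by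
  have h' : φ - C₁ ≠ 0 := sub_ne_zero.2 h
  have h'' : C₁ - φ ≠ 0 := sub_ne_zero.2 h.symm
  have hd : HasDerivAt (fun y : ℝ => 2 * (y - C₁)) 2 φ := by
    simpa using ((hasDerivAt_id φ).sub_const C₁).const_mul 2
  have := (((((hasDerivAt_id φ).pow 2).const_mul (-(1 / 2) : ℝ)).sub
    ((hasDerivAt_id φ).const_mul (1 / 2 * C₂))).sub_const (1 / 2 * C₁ * C₂)).sub
      ((hasDerivAt_const φ C₃).div hd (by simpa using h'))
  convert! this using 1
  rw [show C₁ - φ = -(φ - C₁) by ring]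
  simp only [id]
  field_simp
  ring

/-- Multiplying the singular part by `2 (φ - C₁)` gives `C₃` off the pole, whereas continuity would
force the limit `0`. -/
lemma not_continuousAt_U {C₁ C₂ C₃ : ℝ} (h : C₃ ≠ 0) : ¬ ContinuousAt (U C₁ C₂ C₃) C₁ := by
  intro hc
  have h1 : ContinuousAt (fun φ => 2 * (φ - C₁) *
      (-(1 / 2) * φ ^ 2 - 1 / 2 * C₂ * φ - 1 / 2 * C₁ * C₂ - U C₁ C₂ C₃ φ)) C₁ := by fun_prop
  have h2 := h1.tendsto.mono_left (nhdsWithin_le_nhds (s := {C₁}ᶜ))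
  rw [sub_self, mul_zero, zero_mul] at h2
  refine h (tendsto_nhds_unique (h2.congr' ?_) tendsto_const_nhds).symm
  filter_upwards [self_mem_nhdsWithin] with φ hφ
  have : φ - C₁ ≠ 0 := sub_ne_zero.2 hφ
  rw [U]
  field_simp
  ring

lemma mem_critSet {C₁ C₂ C₃ φ : ℝ} (h : C₃ ≠ 0) : φ ∈ critSet C₁ C₂ C₃ ↔
    (C₁ - φ) ^ 2 * (2 * C₁ + C₂ - 2 * (C₁ - φ)) - C₃ = 0 := by
  rw [critSet, mem_ofPred_eq]
  rcases eq_or_ne φ C₁ with rfl | hne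
  · simp only [sub_self, ne_eq, OfNat.ofNat_ne_zero, not_false_eq_true, zero_pow, zero_mul,
      zero_sub, neg_eq_zero, h, iff_false]
    exact fun hd => not_continuousAt_U h hd.continuousAt
  · have hd := hasDerivAt_U C₁ C₂ C₃ hne
    have h2 : 2 * (C₁ - φ) ^ 2 ≠ 0 := by
      have := sub_ne_zero.2 hne.symm
      positivity
    constructor
    · intro h0
      have := hd.unique h0
      rw [div_eq_zero_iff, or_iff_left h2] at this
      linarith
    · intro h0
      rwa [show C₃ - (C₁ - φ) ^ 2 * (2 * C₁ + C₂ - 2 * (C₁ - φ)) = 0 by linarith, zero_div] at hd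

/-- On `[0, a / 2]` the maximum of `x² (a - 2 x)` is `a³ / 27`, at `a / 3`, which explains the
critical value. The roots are numbered so that `C₁ - x₁ < C₁ - x₂ < C₁ - x₃`. -/
lemma exists_cubic_roots {a c : ℝ} (ha : 0 < a) (hc : 0 < c) (hca : c < 1 / 27 * a ^ 3) :
    ∃ x₁ x₂ x₃ : ℝ, x₃ < 0 ∧ 0 < x₂ ∧ x₂ < a / 3 ∧ a / 3 < x₁ ∧ x₁ < a / 2 ∧
      ∀ x, x ^ 2 * (a - 2 * x) - c = -2 * (x - x₁) * (x - x₂) * (x - x₃) := by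
  have hcont : Continuous fun x : ℝ => x ^ 2 * (a - 2 * x) - c := by fun_prop
  have v3 : 0 < (a / 3) ^ 2 * (a - 2 * (a / 3)) - c := by ring_nf at hca ⊢; linarith
  obtain ⟨x₁, ⟨h11, h12⟩, e1⟩ := intermediate_value_Ioo' (by linarith : a / 3 ≤ a / 2)
    hcont.continuousOn ⟨by ring_nf; linarith, v3⟩
  obtain ⟨x₂, ⟨h21, h22⟩, e2⟩ := intermediate_value_Ioo (by linarith : 0 ≤ a / 3)
    hcont.continuousOn ⟨by ring_nf; linarith, v3⟩
  -- At `-(1 + c)` the cubic is `(1 + c)² (a + 2 (1 + c)) - c > 0`.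
  obtain ⟨x₃, ⟨h31, h32⟩, e3⟩ := intermediate_value_Ioo' (by linarith : -(1 + c) ≤ 0)
    hcont.continuousOn (show (0 : ℝ) ∈ _ from ⟨by ring_nf; linarith, by
      have : 0 < (1 + c) ^ 2 * a + (2 * c ^ 3 + 6 * c ^ 2 + 5 * c + 2) := by positivity
      linarith⟩)
  refine ⟨x₁, x₂, x₃, h32, h21, h22, h11, h12, fun x => ?_⟩
  simp only at e1 e2 e3
  -- Vieta's relations come from divided differences of the three root equations.
  have d12 : a * (x₁ + x₂) = 2 * (x₁ ^ 2 + x₁ * x₂ + x₂ ^ 2) := by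
    refine mul_left_cancel₀ (sub_ne_zero.2 (h22.trans h11).ne') ?_
    linarith
  have d13 : a * (x₁ + x₃) = 2 * (x₁ ^ 2 + x₁ * x₃ + x₃ ^ 2) := by
    have : x₁ - x₃ ≠ 0 := by linarith
    refine mul_left_cancel₀ this ?_
    linarith
  have d : a = 2 * (x₁ + x₂ + x₃) := by
    have : x₂ - x₃ ≠ 0 := by linarith
    refine mul_left_cancel₀ this ?_
    linarith
  subst d
  linear_combination e1 + (x - x₁) * d12

/-! ### Existence of the turning points. -/

lemma csInf_inter_eq {s t : Set ℝ} {x : ℝ} (hs : x ∈ s) (ht : x ∈ t)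
    (h : ∀ y ∈ s, y ∈ t → y = x) : sInf (s ∩ t) = x := by
  have : s ∩ t = {x} := Subset.antisymm (fun y hy => h y hy.1 hy.2) (by simp [hs, ht])
  rw [this, csInf_singleton]

lemma continuousOn_U (C₁ C₂ C₃ : ℝ) {s : Set ℝ} (hs : ∀ φ ∈ s, φ ≠ C₁) :
    ContinuousOn (U C₁ C₂ C₃) s :=
  fun _ hφ => (hasDerivAt_U C₁ C₂ C₃ (hs _ hφ)).continuousAt.continuousWithinAt

/-- `U` tends to `+∞` on the left of its pole. -/
lemma exists_lt_U {C₁ C₂ C₃ y : ℝ} (hC₃ : 0 < C₃) (hy : 0 < y) (hya : y < 2 * C₁ + C₂) (b : ℝ) :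
    ∃ x, 0 < x ∧ x < y ∧ b < U C₁ C₂ C₃ (C₁ - x) := by
  set D := b + C₁ ^ 2 / 2 + C₁ * C₂ with hD
  have hD0 : 0 < 2 * |D| + 1 := by positivity
  -- The second bound makes `C₃ / x` exceed `2 D`; the first keeps `x (2 C₁ + C₂ - x)` positive.
  have hx : 0 < min (y / 2) (C₃ / (2 * |D| + 1)) := by positivity
  set x := min (y / 2) (C₃ / (2 * |D| + 1))
  have hxy : x ≤ y / 2 := min_le_left _ _
  refine ⟨x, hx, by linarith, ?_⟩
  have h1 : 2 * |D| + 1 ≤ C₃ / x := by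
    rw [le_div_iff₀' hx, ← le_div_iff₀ hD0]
    exact min_le_right _ _
  have h2 : 0 < x * (2 * C₁ + C₂ - x) := mul_pos hx (by linarith)
  rw [U_sub]
  linarith [le_abs_self D]

/-- Existence of the turning points below the energy of the saddle, in the coordinate `C₁ - φ`. -/
lemma exists_turning_points {C₁ C₂ C₃ x₁ x₂ b : ℝ} (hC₃ : 0 < C₃) (h2 : 0 < x₂) (h21 : x₂ < x₁)
    (h2a : x₂ < 2 * C₁ + C₂) (hb₂ : U C₁ C₂ C₃ (C₁ - x₂) < b) (hb₁ : b < U C₁ C₂ C₃ (C₁ - x₁)) :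
    ∃ p q, 0 < p ∧ p < x₂ ∧ x₂ < q ∧ q < x₁ ∧ x₁ < 2 * C₁ + C₂ - p - q ∧
      U C₁ C₂ C₃ (C₁ - p) = b ∧ U C₁ C₂ C₃ (C₁ - q) = b := by
  obtain ⟨x, hx, hx2, hbx⟩ := exists_lt_U hC₃ h2 h2a b
  obtain ⟨φ, ⟨hφ1, hφ2⟩, hφ⟩ := intermediate_value_Ioo (by linarith : C₁ - x₂ ≤ C₁ - x)
    (continuousOn_U C₁ C₂ C₃ fun φ hφ => by linarith [hφ.2]) ⟨hb₂, hbx⟩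
  obtain ⟨ψ, ⟨hψ1, hψ2⟩, hψ⟩ := intermediate_value_Ioo' (by linarith : C₁ - x₁ ≤ C₁ - x₂)
    (continuousOn_U C₁ C₂ C₃ fun φ hφ => by linarith [hφ.2]) ⟨hb₂, hb₁⟩
  have hUp : U C₁ C₂ C₃ (C₁ - (C₁ - φ)) = b := by rwa [sub_sub_cancel]
  have hUq : U C₁ C₂ C₃ (C₁ - (C₁ - ψ)) = b := by rwa [sub_sub_cancel]
  refine ⟨C₁ - φ, C₁ - ψ, by linarith, by linarith, by linarith, by linarith, ?_, hUp, hUq⟩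
  -- At `x₁` the difference `b - U` is negative and `x₁` exceeds both turning points, so the factor
  -- of the third root must be positive.
  have hf := two_mul_sub_U (by linarith) (by linarith) hUp hUq (h2.trans h21).ne'
  by_contra! hle
  have : 0 ≤ (x₁ - (C₁ - φ)) * (C₁ - ψ - x₁) * (2 * C₁ + C₂ - (C₁ - φ) - (C₁ - ψ) - x₁) / x₁ :=
    div_nonneg (mul_nonneg_of_nonpos_of_nonpos
      (mul_nonpos_of_nonneg_of_nonpos (by linarith) (by linarith)) (by linarith)) (by linarith)
  linarith

end DGH

open DGH

/-! ### Identification of the critical and turning points, and monotonicity of the period. -/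

/-- For `2 C₁ + C₂ > 0` and `0 < C₃ < C₃critical` the smooth periodic waves are parameterized by
`b ∈ (b₋, b₊)`, and their period function is strictly increasing in `b`. The first three parts say
that the objects entering the period function are what their definitions announce (critical
points, non-degenerate energy range, turning points, convergent integral). -/
theorem theorem2 (C₁ C₂ C₃ : ℝ) (hC : 0 < 2 * C₁ + C₂)
    (hC₃ : C₃ ∈ Set.Ioo 0 (DGH.C₃critical C₁ C₂)) :
    (DGH.critSet C₁ C₂ C₃ = {DGH.φ₁ C₁ C₂ C₃, DGH.φ₂ C₁ C₂ C₃, DGH.φ₃ C₁ C₂ C₃} ∧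
      -C₂ / 2 < DGH.φ₁ C₁ C₂ C₃ ∧ DGH.φ₁ C₁ C₂ C₃ < (C₁ - C₂) / 3 ∧
      (C₁ - C₂) / 3 < DGH.φ₂ C₁ C₂ C₃ ∧ DGH.φ₂ C₁ C₂ C₃ < C₁ ∧ C₁ < DGH.φ₃ C₁ C₂ C₃) ∧
    DGH.bMinus C₁ C₂ C₃ < DGH.bPlus C₁ C₂ C₃ ∧
    (∀ b ∈ Set.Ioo (DGH.bMinus C₁ C₂ C₃) (DGH.bPlus C₁ C₂ C₃),
      {φ | φ ∈ Set.Ioo (DGH.φ₁ C₁ C₂ C₃) C₁ ∧ DGH.U C₁ C₂ C₃ φ = b}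
          = {DGH.φMinus C₁ C₂ C₃ b, DGH.φPlus C₁ C₂ C₃ b} ∧
        DGH.φ₁ C₁ C₂ C₃ < DGH.φMinus C₁ C₂ C₃ b ∧
        DGH.φMinus C₁ C₂ C₃ b < DGH.φ₂ C₁ C₂ C₃ ∧
        DGH.φ₂ C₁ C₂ C₃ < DGH.φPlus C₁ C₂ C₃ b ∧
        DGH.φPlus C₁ C₂ C₃ b < C₁ ∧
        (∀ φ ∈ Set.Ioo (DGH.φMinus C₁ C₂ C₃ b) (DGH.φPlus C₁ C₂ C₃ b),
          DGH.U C₁ C₂ C₃ φ < b) ∧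
        IntervalIntegrable (DGH.periodIntegrand C₁ C₂ C₃ b) MeasureTheory.volume
          (DGH.φMinus C₁ C₂ C₃ b) (DGH.φPlus C₁ C₂ C₃ b)) ∧
    StrictMonoOn (DGH.period C₁ C₂ C₃)
      (Set.Ioo (DGH.bMinus C₁ C₂ C₃) (DGH.bPlus C₁ C₂ C₃)) := by
  obtain ⟨hc, hca⟩ := hC₃
  obtain ⟨x₁, x₂, x₃, h3, h2, h2a, h1a, h1, hfac⟩ := exists_cubic_roots hC hc hca
  have h21 : x₂ < x₁ := h2a.trans h1a
  have hmem : ∀ φ, φ ∈ critSet C₁ C₂ C₃ ↔ φ = C₁ - x₁ ∨ φ = C₁ - x₂ ∨ φ = C₁ - x₃ := by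
    intro φ
    rw [mem_critSet hc.ne', hfac]
    constructor
    · intro h
      rcases mul_eq_zero.1 h with h | h
      · rcases mul_eq_zero.1 h with h | h
        · left; linarith
        · right; left; linarith
      · right; right; linarith
    · rintro (rfl | rfl | rfl) <;> ring
  have e1 : φ₁ C₁ C₂ C₃ = C₁ - x₁ := by
    refine csInf_inter_eq ((hmem _).2 (by simp)) ⟨by linarith, by linarith⟩ fun y hy hy' => ?_
    rcases (hmem y).1 hy with h | h | h
    · exact h
    · linarith [hy'.2]
    · linarith [hy'.2]
  have e2 : φ₂ C₁ C₂ C₃ = C₁ - x₂ := by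
    refine csInf_inter_eq ((hmem _).2 (by simp)) ⟨by linarith, by linarith⟩ fun y hy hy' => ?_
    rcases (hmem y).1 hy with h | h | h
    · linarith [hy'.1]
    · exact h
    · linarith [hy'.2]
  have e3 : φ₃ C₁ C₂ C₃ = C₁ - x₃ := by
    refine csInf_inter_eq ((hmem _).2 (by simp)) (show C₁ < C₁ - x₃ by linarith)
      fun y hy (hy' : C₁ < y) => ?_
    rcases (hmem y).1 hy with h | h | h
    · linarith
    · linarith
    · exact h
  have hanti : StrictAntiOn (U C₁ C₂ C₃) (Icc (C₁ - x₁) (C₁ - x₂)) := by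
    refine strictAntiOn_of_deriv_neg (convex_Icc _ _)
      (continuousOn_U _ _ _ fun φ hφ => by linarith [hφ.2]) fun φ hφ => ?_
    rw [interior_Icc] at hφ
    have hφC : 0 < C₁ - φ := by linarith [hφ.2]
    rw [(hasDerivAt_U C₁ C₂ C₃ (by linarith)).deriv]
    refine div_neg_of_neg_of_pos ?_ (by positivity)
    have := mul_pos (mul_pos (show 0 < x₁ - (C₁ - φ) by linarith [hφ.1])
      (show 0 < C₁ - φ - x₂ by linarith [hφ.2])) (show 0 < C₁ - φ - x₃ by linarith)
    linarith [hfac (C₁ - φ)]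
  have hturn : ∀ b ∈ Ioo (bMinus C₁ C₂ C₃) (bPlus C₁ C₂ C₃), ∃ p q, 0 < p ∧ p < x₂ ∧ x₂ < q ∧
      q < x₁ ∧ x₁ < 2 * C₁ + C₂ - p - q ∧ U C₁ C₂ C₃ (C₁ - p) = b ∧ U C₁ C₂ C₃ (C₁ - q) = b ∧
      (∀ φ ∈ Ioo (C₁ - x₁) C₁, U C₁ C₂ C₃ φ = b → φ = C₁ - q ∨ φ = C₁ - p) ∧
      φMinus C₁ C₂ C₃ b = C₁ - q ∧ φPlus C₁ C₂ C₃ b = C₁ - p := by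
    intro b hb
    rw [bMinus, bPlus, e1, e2] at hb
    obtain ⟨p, q, hp, hp2, hq2, hq1, hr, hUp, hUq⟩ :=
      exists_turning_points hc h2 h21 (by linarith) hb.1 hb.2
    have huniq : ∀ φ ∈ Ioo (C₁ - x₁) C₁, U C₁ C₂ C₃ φ = b → φ = C₁ - q ∨ φ = C₁ - p := by
      intro φ hφ hU
      have hx : C₁ - φ ≠ 0 := by linarith [hφ.2]
      have h := two_mul_sub_U hp (hp2.trans hq2) hUp hUq hx
      rw [sub_sub_cancel, hU, sub_self, mul_zero, eq_comm, div_eq_zero_iff, or_iff_left hx] at h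
      rcases mul_eq_zero.1 h with h | h
      · rcases mul_eq_zero.1 h with h | h
        · right; linarith
        · left; linarith
      -- The third root exceeds `x₁`, so it lies on the far side of the saddle.
      · linarith [hφ.1]
    refine ⟨p, q, hp, hp2, hq2, hq1, hr, hUp, hUq, huniq, ?_, ?_⟩
    · rw [φMinus, e1, e2]
      refine csInf_inter_eq (s := Ioo (C₁ - x₁) (C₁ - x₂)) (t := {φ | U C₁ C₂ C₃ φ = b})
        ⟨by linarith, by linarith⟩ hUq fun y hy hy' => ?_
      rcases huniq y ⟨hy.1, by linarith [hy.2]⟩ hy' with h | h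
      · exact h
      · linarith [hy.2]
    · rw [φPlus, e2]
      refine csInf_inter_eq (s := Ioo (C₁ - x₂) C₁) (t := {φ | U C₁ C₂ C₃ φ = b})
        ⟨by linarith, by linarith⟩ hUp fun y hy hy' => ?_
      rcases huniq y ⟨by linarith [hy.1], hy.2⟩ hy' with h | h
      · linarith [hy.1]
      · exact h
  refine ⟨⟨?_, by linarith, by linarith, by linarith, by linarith, by linarith⟩, ?_, ?_, ?_⟩
  · ext φ
    rw [hmem, e1, e2, e3]
    rfl
  · rw [bMinus, bPlus, e1, e2]
    exact hanti ⟨le_rfl, by linarith⟩ ⟨by linarith, le_rfl⟩ (by linarith)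
  · intro b hb
    obtain ⟨p, q, hp, hp2, hq2, hq1, hr, hUp, hUq, huniq, eq, ep⟩ := hturn b hb
    rw [eq, ep, e1, e2]
    refine ⟨?_, by linarith, by linarith, by linarith, by linarith, fun φ hφ => ?_,
      intervalIntegrable_periodIntegrand hp (hp2.trans hq2) (hq1.trans hr) hUp hUq⟩
    · ext φ
      refine ⟨fun h => huniq φ h.1 h.2, ?_⟩
      rintro (rfl | rfl)
      · exact ⟨⟨by linarith, by linarith⟩, hUq⟩
      · exact ⟨⟨by linarith, by linarith⟩, hUp⟩
    · obtain ⟨hφ1, hφ2⟩ := hφ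
      have hx : 0 < C₁ - φ := by linarith
      have h := two_mul_sub_U hp (hp2.trans hq2) hUp hUq hx.ne'
      have := div_pos (mul_pos (mul_pos (show 0 < C₁ - φ - p by linarith)
        (show 0 < q - (C₁ - φ) by linarith))
        (show 0 < 2 * C₁ + C₂ - p - q - (C₁ - φ) by linarith)) hx
      rw [sub_sub_cancel] at h
      linarith
  · intro b hb b' hb' hbb
    obtain ⟨p, q, hp, hp2, hq2, hq1, hr, hUp, hUq, -, eq, ep⟩ := hturn b hb
    obtain ⟨p', q', hp', hp2', hq2', hq1', hr', hUp', hUq', -, eq', ep'⟩ := hturn b' hb'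
    have hpq := hp2.trans hq2
    have hpq' := hp2'.trans hq2'
    set r := 2 * C₁ + C₂ - p - q with hrdef
    set r' := 2 * C₁ + C₂ - p' - q' with hrdef'
    -- Each root at energy `b` makes the cubic at energy `b' > b` positive, hence lies in `(p', q')`
    -- or beyond `r'`. Since `x₂` separates `p, p'` from `q, q'`, and `x₁` separates these from `r,
    -- r'`, the shift of each root is determined.
    have hsign : ∀ x, 0 < x → U C₁ C₂ C₃ (C₁ - x) = b → 0 < (x - p') * (q' - x) * (r' - x) := by
      intro x hx hU
      have h := two_mul_sub_U hp' hpq' hUp' hUq' hx.ne'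
      rw [hU, eq_div_iff hx.ne'] at h
      rw [hrdef', ← h]
      exact mul_pos (by linarith) hx
    have hr0 : 0 < r := by linarith
    have hUr : U C₁ C₂ C₃ (C₁ - r) = b := by
      have h := two_mul_sub_U hp hpq hUp hUq hr0.ne'
      rw [← hrdef, sub_self, mul_zero, zero_div] at h
      linarith
    have hpp : p' < p := by
      have h := hsign p hp hUp
      by_contra! hle
      have := mul_nonpos_of_nonpos_of_nonneg (mul_nonpos_of_nonpos_of_nonneg
        (show p - p' ≤ 0 by linarith) (show 0 ≤ q' - p by linarith))
        (show 0 ≤ r' - p by linarith)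
      linarith
    have hqq : q < q' := by
      have h := hsign q (hp.trans hpq) hUq
      by_contra! hle
      have := mul_nonpos_of_nonpos_of_nonneg (mul_nonpos_of_nonneg_of_nonpos
        (show 0 ≤ q - p' by linarith) (show q' - q ≤ 0 by linarith))
        (show 0 ≤ r' - q by linarith)
      linarith
    have hrr : r' < r := by
      have h := hsign r hr0 hUr
      by_contra! hle
      have := mul_nonpos_of_nonpos_of_nonneg (mul_nonpos_of_nonneg_of_nonpos
        (show 0 ≤ r - p' by linarith) (show q' - r ≤ 0 by linarith))
        (show 0 ≤ r' - r by linarith)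
      linarith
    rw [period, period, eq, ep, eq', ep', integral_periodIntegrand hp hpq hUp hUq,
      integral_periodIntegrand hp' hpq' hUp' hUq']
    refine mul_lt_mul_of_pos_left (integral_profile_lt hp' hpp hpq hqq (hq1'.trans hr') hrr
      (by linarith) ?_) two_pos
    rw [mul_turning_points hp hpq hUp hUq, mul_turning_points hp' hpq' hUp' hUq']
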